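/- Let $A,B,A',B'$ be nonzero finite-dimensional complex Hilbert spaces. For such spaces $I,O$ write $\mathrm{L}(I)$ for the linear operators on $I$, $\mathrm{T}(I\to O)$ for the linear maps $\mathrm{L}(I)\to\mathrm{L}(O)$, $\mathrm{HP}(I\to O)\subset\mathrm{T}(I\to O)$ for the Hermitian-preserving ones, $\mathrm{CP}(I\to O)$ for the completely positive ones and $\mathrm{CPTP}(I\to O)$ for the completely positive trace-preserving ones. A discrete quantum instrument from $I$ to $O$ is a finite or countable family $(\mathcal E_i)_i$ of nonzero maps in $\mathrm{CP}(I\to O)$ with $\sum_i\mathcal E_i\in\mathrm{CPTP}(I\to O)$. Let $\mathrm{QI}_{\mathrm{LO}}$ be the set of all families $(\mathcal E_i\otimes\mathcal F_j)_{i,j}$ with $(\mathcal E_i)_i$ a discrete quantum instrument from $A$ to $A'$ and $(\mathcal F_j)_j$ one from $B$ to $B'$, and put $$\mathrm{LO}=\Big\{\sum_k\mathcal G_k:(\mathcal G_k)_k\in\mathrm{QI}_{\mathrm{LO}}\Big\},\qquad \mathrm{LO}^\star=\Big\{\sum_k w_k\,\mathcal G_k:(\mathcal G_k)_k\in\mathrm{QI}_{\mathrm{LO}},\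 w_k\in[-1,1]\Big\}.$$ For $S\subset\mathrm{T}(AB\to A'B')$ and $\mathcal E\in\mathrm{T}(AB\to A'B')$ let $$\gamma_S(\mathcal E)=\inf\Big\{\sum_{i=1}^m|c_i| : \mathcal E=\sum_{i=1}^m c_i\mathcal F_i,\ m\ge1,\ \mathcal F_i\in S,\ c_i\in\mathbb R\Big\}\in[0,\infty],$$ with $\inf\emptyset=\infty$. Let $\mathrm{NSIG}$ be the set of non-signalling maps, i.e. of those $\mathcal E\in\mathrm{HP}(AB\to A'B')$ such that for all density operators $\rho,\sigma$ on $AB$: if $\mathrm{tr}_B\rho=\mathrm{tr}_B\sigma$ then $\mathrm{tr}_{B'}\mathcal E(\rho)=\mathrm{tr}_{B'}\mathcal E(\sigma)$, and if $\mathrm{tr}_A\rho=\mathrm{tr}_A\sigma$ then $\mathrm{tr}_{A'}\mathcal E(\rho)=\mathrm{tr}_{A'}\mathcal E(\sigma)$. Then $$\mathrm{span}_{\mathbb R}(\mathrm{LO})=\mathrm{NSIG},\qquad \mathrm{span}_{\mathbb R}(\mathrm{LO}^\star)=\mathrm{HP}(AB\to A'B').$$ Consequently, for $\mathcal E\in\mathrm{T}(AB\to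 A'B')$, $\gamma_{\mathrm{LO}}(\mathcal E)<\infty$ if and only if $\mathcal E\in\mathrm{NSIG}$, and $\gamma_{\mathrm{LO}^\star}(\mathcal E)<\infty$ if and only if $\mathcal E\in\mathrm{HP}(AB\to A'B')$; in particular $\gamma_{\mathrm{LO}^\star}(\mathcal E)<\infty$ for every $\mathcal E\in\mathrm{CPTP}(AB\to A'B')$. -/

import Mathlib

open scoped Kronecker ComplexOrder

namespace CircuitCutting

/-- `T(I → O)`: linear superoperators, for `I = ℂ^m` and `O = ℂ^n` (operators are matrices). -/
abbrev Superop (m n : Type*) := Matrix m m ℂ →ₗ[ℂ] Matrix n n ℂ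

section Basic

variable {m n : Type*} [Fintype m] [Fintype n]

/-- Density matrices. -/
def IsDensity (ρ : Matrix m m ℂ) : Prop := ρ.PosSemidef ∧ ρ.trace = 1

/-- Hermitian-preserving superoperators. -/
def HP (m n : Type*) : Set (Superop m n) :=
  {E | ∀ X : Matrix m m ℂ, X.IsHermitian → (E X).IsHermitian}

/-- Trace-preserving superoperators. -/
def TP (m n : Type*) [Fintype m] [Fintype n] : Set (Superop m n) :=
  {E | ∀ X : Matrix m m ℂ, (E X).trace = X.trace}

/-- `(id_k ⊗ E)(M)`: the map `E` is applied to every `m × m` block of `M`. -/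
def ampliation (k : ℕ) (E : Superop m n) (M : Matrix (Fin k × m) (Fin k × m) ℂ) :
    Matrix (Fin k × n) (Fin k × n) ℂ :=
  Matrix.of fun x y => E (Matrix.of fun p q => M (x.1, p) (y.1, q)) x.2 y.2

/-- Completely positive superoperators: `id_k ⊗ E` is positive for every `k`. -/
def CP (m n : Type*) [Fintype m] [Fintype n] : Set (Superop m n) :=
  {E | ∀ (k : ℕ) (M : Matrix (Fin k × m) (Fin k × m) ℂ),
    M.PosSemidef → (ampliation k E M).PosSemidef}

/-- Quantum channels. -/
def CPTP (m n : Type*) [Fintype m] [Fintype n] : Set (Superop m n) := CP m n ∩ TP m n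

end Basic

section Bipartite

variable {a b a' b' : Type*}

/-- `tr_B : L(AB) → L(A)`. -/
def traceB [Fintype b] (X : Matrix (a × b) (a × b) ℂ) : Matrix a a ℂ :=
  Matrix.of fun i j => ∑ k, X (i, k) (j, k)

/-- `tr_A : L(AB) → L(B)`. -/
def traceA [Fintype a] (X : Matrix (a × b) (a × b) ℂ) : Matrix b b ℂ :=
  Matrix.of fun k l => ∑ i, X (i, k) (i, l)

variable [Fintype a] [Fintype b] [DecidableEq a] [DecidableEq b]

/-- The tensor product `E ⊗ F` of superoperators: `X = ∑ X_{(p,r),(q,s)} e_{pq} ⊗ e_{rs}` is sent to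
`∑ X_{(p,r),(q,s)} E(e_{pq}) ⊗ F(e_{rs})`. -/
noncomputable def tensor (E : Superop a a') (F : Superop b b') : Superop (a × b) (a' × b') where
  toFun X := ∑ p : a, ∑ q : a, ∑ r : b, ∑ s : b,
    X (p, r) (q, s) • (E (Matrix.single p q 1) ⊗ₖ F (Matrix.single r s 1))
  map_add' X Y := by
    simp only [Matrix.add_apply, add_smul, Finset.sum_add_distrib]
  map_smul' c X := by
    simp only [Matrix.smul_apply, smul_eq_mul, mul_smul, Finset.smul_sum, RingHom.id_apply]

/-- Sanity check of the definition: it is characterised by its action on product operators. -/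
theorem tensor_kronecker (E : Superop a a') (F : Superop b b')
    (X : Matrix a a ℂ) (Y : Matrix b b ℂ) : tensor E F (X ⊗ₖ Y) = E X ⊗ₖ F Y := by
  have hX : E X = ∑ p, ∑ q, X p q • E (Matrix.single p q 1) := by
    conv_lhs => rw [Matrix.matrix_eq_sum_single X]
    simp only [map_sum]
    refine Finset.sum_congr rfl fun p _ => Finset.sum_congr rfl fun q _ => ?_
    rw [← map_smul, Matrix.smul_single, smul_eq_mul, mul_one]
  have hY : F Y = ∑ r, ∑ s, Y r s • F (Matrix.single r s 1) := by
    conv_lhs => rw [Matrix.matrix_eq_sum_single Y]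
    simp only [map_sum]
    refine Finset.sum_congr rfl fun p _ => Finset.sum_congr rfl fun q _ => ?_
    rw [← map_smul, Matrix.smul_single, smul_eq_mul, mul_one]
  ext x y
  simp only [tensor, LinearMap.coe_mk, AddHom.coe_mk, Matrix.kroneckerMap_apply, hX, hY,
    Matrix.sum_apply, Matrix.smul_apply, smul_eq_mul]
  simp only [Finset.sum_mul]
  simp only [Finset.mul_sum]
  refine Finset.sum_congr rfl fun p _ => Finset.sum_congr rfl fun q _ =>
    Finset.sum_congr rfl fun r _ => Finset.sum_congr rfl fun s _ => ?_
  ring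

end Bipartite

/-- A discrete (finite or countably infinite) family of superoperators. -/
structure Family (m n : Type*) where
  /-- the set of outcomes -/
  ι : Type
  countable : Countable ι
  /-- the superoperator of each outcome -/
  map : ι → Superop m n

/-- `G` sums to `E`, in the usual topology of the finite-dimensional space `L(O)` at every input. -/
def Family.SumsTo {m n : Type*} (G : Family m n) (E : Superop m n) : Prop :=
  ∀ X : Matrix m m ℂ, HasSum (fun i => G.map i X) (E X)

/-- `(w_i G_i)_i` for real weights `w_i`. -/
noncomputable def Family.weight {m n : Type*} (G : Family m n) (w : G.ι → ℝ) : Family m n where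
  ι := G.ι
  countable := G.countable
  map i := w i • G.map i

/-- `(E_i ⊗ F_j)_{i,j}`. -/
noncomputable def Family.tensor {a b a' b' : Type*} [Fintype a] [Fintype b]
    [DecidableEq a] [DecidableEq b] (E : Family a a') (F : Family b b') :
    Family (a × b) (a' × b') where
  ι := E.ι × F.ι
  countable := by
    have := E.countable
    have := F.countable
    infer_instance
  map x := CircuitCutting.tensor (E.map x.1) (F.map x.2)

/-- Discrete quantum instruments: discrete families of nonzero completely positive maps whose sum
is a quantum channel. -/
def QI (m n : Type*) [Fintype m] [Fintype n] : Set (Family m n) :=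
  {G | (∀ i, G.map i ∈ CP m n ∧ G.map i ≠ 0) ∧ ∃ E ∈ CPTP m n, G.SumsTo E}

/-- The channels `∑ G_i` induced by a set `Q` of instruments. -/
def inducedChannels {m n : Type*} (Q : Set (Family m n)) : Set (Superop m n) :=
  {E | ∃ G ∈ Q, G.SumsTo E}

/-- `𝓛[Q]`: the maps `∑ w_i G_i` with `(G_i)_i ∈ Q` and weights `w_i ∈ [-1, 1]`. -/
def sideInfo {m n : Type*} (Q : Set (Family m n)) : Set (Superop m n) :=
  {E | ∃ G ∈ Q, ∃ w : G.ι → ℝ, (∀ i, w i ∈ Set.Icc (-1 : ℝ) 1) ∧ (G.weight w).SumsTo E}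

section Local

variable (a b a' b' : Type*) [Fintype a] [Fintype b] [Fintype a'] [Fintype b']
  [DecidableEq a] [DecidableEq b]

/-- Product instruments `(E_i ⊗ F_j)_{i,j}` of local instruments. -/
def QILO : Set (Family (a × b) (a' × b')) :=
  {G | ∃ E ∈ QI a a', ∃ F ∈ QI b b', G = E.tensor F}

/-- Local operations. -/
def LO : Set (Superop (a × b) (a' × b')) := inducedChannels (QILO a b a' b')

/-- Local operations with classical side information. -/
def LOStar : Set (Superop (a × b) (a' × b')) := sideInfo (QILO a b a' b')

/-- Non-signalling Hermitian-preserving maps: the output on either side depends only on the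
input on that side. -/
def NSIG (a b a' b' : Type*) [Fintype a] [Fintype b] [Fintype a'] [Fintype b'] :
    Set (Superop (a × b) (a' × b')) :=
  {E | E ∈ HP (a × b) (a' × b') ∧
    (∀ ρ σ : Matrix (a × b) (a × b) ℂ, IsDensity ρ → IsDensity σ →
      traceB ρ = traceB σ → traceB (E ρ) = traceB (E σ)) ∧
    (∀ ρ σ : Matrix (a × b) (a × b) ℂ, IsDensity ρ → IsDensity σ →
      traceA ρ = traceA σ → traceA (E ρ) = traceA (E σ))}

end Local

/-- The quasiprobability extent `γ_S(E)`; the infimum over the empty set is `∞`. -/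
noncomputable def extent {m n : Type*} (S : Set (Superop m n)) (E : Superop m n) : ENNReal :=
  sInf {t | ∃ (k : ℕ) (c : Fin k → ℝ) (F : Fin k → Superop m n), 1 ≤ k ∧ (∀ i, F i ∈ S) ∧
    E = ∑ i, c i • F i ∧ t = ENNReal.ofReal (∑ i, |c i|)}

end CircuitCutting

open CircuitCutting

/-!
Write `M ▹ N` for the measure-and-prepare map `X ↦ tr(M X) N`. With effects `M` and density matrices
`N` these maps span all superoperators over `ℂ`, and so do their tensor products. A complex linear
combination of Hermitian-preserving maps which preserves Hermiticity keeps its value when every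
coefficient is replaced by its real part, so the same maps span `HP` over `ℝ`. Since
`M ▹ N + (1 - M) ▹ N` is a channel, `M ▹ N` is a member of an instrument, and the weights `1` and
`0` select it; hence products of such maps lie in `LO⋆`.

Let `D` and `D'` discard one party's system and prepare a fixed density matrix on its input and its
output space, respectively. A non-signalling `E` satisfies `D' ∘ E = D' ∘ E ∘ D`, and is thus fixed
by `E ↦ E - D' ∘ E + D' ∘ E ∘ D`. On products this operation acts on that party's factor alone and
sends it to a real combination of channels: with `τ` the density matrix prepared by `D'`, a factor
`M ▹ N` becomes `(M ▹ N + (1 - M) ▹ τ) + c (1 ▹ τ)` for a real number `c`. Expanding `E` in products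
and applying the operation for both parties exhibits `E` in the real span of products of channels.
-/

namespace CircuitCutting

/-! ### Kronecker products and partial traces -/

section Kronecker

variable {R l m n o : Type*}

@[elab_as_elim]
theorem kronecker_induction [Finite l] [Finite m] [Finite n] [Finite o] [NonAssocSemiring R]
    {p : Matrix (l × n) (m × o) R → Prop}
    (kronecker : ∀ (X : Matrix l m R) (Y : Matrix n o R), p (X ⊗ₖ Y))
    (add : ∀ X Y, p X → p Y → p (X + Y)) (X : Matrix (l × n) (m × o) R) : p X := by
  classical
  refine Matrix.induction_on' X ?_ (fun X Y => add X Y) fun ⟨i, k⟩ ⟨j, t⟩ x => ?_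
  · simpa using kronecker 0 0
  · rw [← mul_one x, ← Matrix.single_kronecker_single]
    exact kronecker _ _

theorem linearMap_ext_kronecker [Finite l] [Finite m] [Finite n] [Finite o] [Semiring R]
    {V : Type*} [AddCommMonoid V] [Module R V] {f g : Matrix (l × n) (m × o) R →ₗ[R] V}
    (h : ∀ (X : Matrix l m R) (Y : Matrix n o R), f (X ⊗ₖ Y) = g (X ⊗ₖ Y)) : f = g :=
  LinearMap.ext fun X => kronecker_induction h (fun X Y hX hY => by rw [map_add, map_add, hX, hY]) X

theorem hasSum_matrix_iff [AddCommMonoid R] [TopologicalSpace R] {ι : Type*} {f : ι → Matrix m n R}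
    {A : Matrix m n R} : HasSum f A ↔ ∀ i j, HasSum (fun k => f k i j) (A i j) :=
  (Pi.hasSum (X := fun _ : m => n → R)).trans (forall_congr' fun _ => Pi.hasSum)

theorem hasSum_mul_of_finiteDimensional [NormedRing R] [NormedSpace ℝ R] [FiniteDimensional ℝ R]
    {ι κ : Type*} {f : ι → R} {g : κ → R} {x y : R} (hf : HasSum f x) (hg : HasSum g y) :
    HasSum (fun i : ι × κ => f i.1 * g i.2) (x * y) := by
  have := FiniteDimensional.complete ℝ R
  exact hf.mul hg (summable_mul_of_summable_norm (summable_norm_iff.2 hf.summable)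
    (summable_norm_iff.2 hg.summable))

theorem hasSum_kronecker [NormedRing R] [NormedSpace ℝ R] [FiniteDimensional ℝ R] {ι κ : Type*}
    {f : ι → Matrix l m R} {g : κ → Matrix n o R} {A : Matrix l m R} {B : Matrix n o R}
    (hf : HasSum f A) (hg : HasSum g B) :
    HasSum (fun i : ι × κ => f i.1 ⊗ₖ g i.2) (A ⊗ₖ B) := by
  refine hasSum_matrix_iff.2 fun x y => ?_
  have hxy := hasSum_mul_of_finiteDimensional (hasSum_matrix_iff.1 hf x.1 y.1)
    (hasSum_matrix_iff.1 hg x.2 y.2)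
  exact hxy

end Kronecker

section PartialTrace

variable {a b : Type*}

section TraceA

variable [Fintype a]

theorem traceA_add (X Y : Matrix (a × b) (a × b) ℂ) : traceA (X + Y) = traceA X + traceA Y := by
  ext; simp [traceA, Finset.sum_add_distrib]

theorem traceA_smul {R : Type*} [DistribSMul R ℂ] (c : R) (X : Matrix (a × b) (a × b) ℂ) :
    traceA (c • X) = c • traceA X := by
  ext; simp [traceA, Finset.smul_sum]

theorem traceA_kronecker (X : Matrix a a ℂ) (Y : Matrix b b ℂ) :
    traceA (X ⊗ₖ Y) = X.trace • Y := by
  ext; simp [traceA, Matrix.trace, Finset.sum_mul]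

theorem trace_traceA [Fintype b] (X : Matrix (a × b) (a × b) ℂ) : (traceA X).trace = X.trace := by
  simp only [Matrix.trace, traceA, Matrix.diag_apply, Matrix.of_apply, Fintype.sum_prod_type]
  exact Finset.sum_comm

theorem posSemidef_traceA {X : Matrix (a × b) (a × b) ℂ} (hX : X.PosSemidef) :
    (traceA X).PosSemidef := by
  have hsum : traceA X = ∑ i, X.submatrix (Prod.mk i) (Prod.mk i) := by
    ext; simp [traceA, Matrix.sum_apply]
  rw [hsum]
  exact Matrix.posSemidef_sum _ fun i _ => hX.submatrix _

end TraceA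

section TraceB

variable [Fintype b]

theorem traceB_add (X Y : Matrix (a × b) (a × b) ℂ) : traceB (X + Y) = traceB X + traceB Y := by
  ext; simp [traceB, Finset.sum_add_distrib]

theorem traceB_smul {R : Type*} [DistribSMul R ℂ] (c : R) (X : Matrix (a × b) (a × b) ℂ) :
    traceB (c • X) = c • traceB X := by
  ext; simp [traceB, Finset.smul_sum]

theorem traceB_kronecker (X : Matrix a a ℂ) (Y : Matrix b b ℂ) :
    traceB (X ⊗ₖ Y) = Y.trace • X := by
  ext; simp [traceB, Matrix.trace, ← Finset.mul_sum, mul_comm]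

theorem trace_traceB [Fintype a] (X : Matrix (a × b) (a × b) ℂ) : (traceB X).trace = X.trace := by
  simp only [Matrix.trace, traceB, Matrix.diag_apply, Matrix.of_apply, Fintype.sum_prod_type]

theorem posSemidef_traceB {X : Matrix (a × b) (a × b) ℂ} (hX : X.PosSemidef) :
    (traceB X).PosSemidef := by
  have hsum : traceB X = ∑ k, X.submatrix (fun i => (i, k)) (fun i => (i, k)) := by
    ext; simp [traceB, Matrix.sum_apply]
  rw [hsum]
  exact Matrix.posSemidef_sum _ fun k _ => hX.submatrix _

end TraceB

end PartialTrace

/-! ### Effects and density matrices -/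

section Density

variable {m n : Type*}

/-- Effects `0 ≤ M ≤ 1`, the elements of a quantum measurement. -/
def IsEffect [DecidableEq m] (M : Matrix m m ℂ) : Prop := M.PosSemidef ∧ (1 - M).PosSemidef

theorem span_isEffect [Finite m] [DecidableEq m] :
    Submodule.span ℂ {M : Matrix m m ℂ | IsEffect M} = ⊤ := by
  cases nonempty_fintype m
  open scoped MatrixOrder Matrix.Norms.L2Operator in
  rw [eq_top_iff, ← CStarAlgebra.span_nonneg_inter_unitClosedBall]
  refine Submodule.span_mono fun M ⟨hM, hM1⟩ => ⟨Matrix.nonneg_iff_posSemidef.1 hM, ?_⟩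
  rw [mem_closedBall_zero_iff] at hM1
  exact Matrix.le_iff.1 ((CStarAlgebra.norm_le_one_iff_of_nonneg M hM).1 hM1)

variable [Fintype m]

theorem span_isDensity : Submodule.span ℂ {ρ : Matrix m m ℂ | IsDensity ρ} = ⊤ := by
  classical
  rw [eq_top_iff, ← span_isEffect, Submodule.span_le]
  rintro M ⟨hM, -⟩
  by_cases h0 : M.trace = 0
  · rw [hM.trace_eq_zero_iff.1 h0]
    exact Submodule.zero_mem _
  · rw [← smul_inv_smul₀ h0 M]
    exact Submodule.smul_mem _ _ (Submodule.subset_span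
      ⟨hM.smul (inv_nonneg.2 hM.trace_nonneg), by simp [h0]⟩)

theorem linearMap_ext_isDensity {V : Type*} [AddCommMonoid V] [Module ℂ V]
    {f g : Matrix m m ℂ →ₗ[ℂ] V} (h : ∀ ρ, IsDensity ρ → f ρ = g ρ) : f = g :=
  LinearMap.ext_on span_isDensity h

theorem exists_isDensity [Nonempty m] : ∃ ρ : Matrix m m ℂ, IsDensity ρ := by
  classical
  obtain ⟨i⟩ := ‹Nonempty m›
  refine ⟨Matrix.diagonal (Pi.single i 1), .diagonal (Pi.single_nonneg.2 zero_le_one), ?_⟩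
  simp [Matrix.trace_diagonal]

variable [Fintype n]

theorem IsDensity.kronecker {ρ : Matrix m m ℂ} {σ : Matrix n n ℂ} (hρ : IsDensity ρ)
    (hσ : IsDensity σ) : IsDensity (ρ ⊗ₖ σ) :=
  ⟨hρ.1.kronecker hσ.1, by rw [Matrix.trace_kronecker, hρ.2, hσ.2, one_mul]⟩

theorem IsDensity.traceA {ρ : Matrix (m × n) (m × n) ℂ} (hρ : IsDensity ρ) :
    IsDensity (traceA ρ) :=
  ⟨posSemidef_traceA hρ.1, (trace_traceA ρ).trans hρ.2⟩

theorem IsDensity.traceB {ρ : Matrix (m × n) (m × n) ℂ} (hρ : IsDensity ρ) :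
    IsDensity (traceB ρ) :=
  ⟨posSemidef_traceB hρ.1, (trace_traceB ρ).trans hρ.2⟩

end Density

/-! ### Hermitian-preserving and completely positive maps -/

section HermitianPreserving

variable {m n : Type*}

theorem map_conjTranspose_of_mem_HP {E : Superop m n} (hE : E ∈ HP m n) (X : Matrix m m ℂ) :
    E X.conjTranspose = (E X).conjTranspose := by
  have hre : (E (realPart X)).conjTranspose = E (realPart X) := hE _ (realPart X).2
  have him : (E (imaginaryPart X)).conjTranspose = E (imaginaryPart X) := hE _ (imaginaryPart X).2
  have hreX : (realPart X : Matrix m m ℂ).conjTranspose = realPart X := (realPart X).2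
  have himX : (imaginaryPart X : Matrix m m ℂ).conjTranspose = imaginaryPart X :=
    (imaginaryPart X).2
  rw [← realPart_add_I_smul_imaginaryPart X]
  simp only [Matrix.conjTranspose_add, Matrix.conjTranspose_smul, map_add, map_smul, hre, him,
    hreX, himX]

theorem linearMap_ext_isHermitian {V : Type*} [AddCommMonoid V] [Module ℂ V]
    {f g : Matrix m m ℂ →ₗ[ℂ] V} (h : ∀ X, X.IsHermitian → f X = g X) : f = g := by
  ext1 X
  rw [← realPart_add_I_smul_imaginaryPart X, map_add, map_add, map_smul, map_smul,
    h _ (realPart X).2, h _ (imaginaryPart X).2]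

/-- On a Hermitian input all `F ∈ S` have Hermitian outputs, so taking real parts in
`E = ∑ i, c i • F i` replaces each `c i` by its real part. -/
theorem mem_span_real_of_mem_HP {S : Set (Superop m n)} (hS : S ⊆ HP m n) {E : Superop m n}
    (hE : E ∈ HP m n) (hES : E ∈ Submodule.span ℂ S) : E ∈ Submodule.span ℝ S := by
  obtain ⟨k, c, F, hc⟩ := Submodule.mem_span_set'.1 hES
  have hre : E = ∑ i, (c i).re • (F i : Superop m n) := by
    refine linearMap_ext_isHermitian fun X hX => ?_
    have hEX : IsSelfAdjoint (E X) := hE X hX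
    have hFX : ∀ i, IsSelfAdjoint ((F i : Superop m n) X) := fun i => hS (F i).2 X hX
    rw [← hEX.coe_realPart, ← hc]
    simp [realPart_smul, (hFX _).coe_realPart, (hFX _).imaginaryPart]
  rw [hre]
  exact Submodule.sum_mem _ fun i _ => Submodule.smul_mem _ _ (Submodule.subset_span (F i).2)

/-- `HP m n` as a real vector space. -/
def hermitianPreserving (m n : Type*) : Submodule ℝ (Superop m n) where
  carrier := HP m n
  zero_mem' := fun X _ => by simp
  add_mem' := fun hE hF X hX => (hE X hX).add (hF X hX)
  smul_mem' := fun c E hE X hX => by simp [Matrix.IsHermitian, (hE X hX).eq]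

variable [Fintype m] [Fintype n]

theorem add_mem_CP {E F : Superop m n} (hE : E ∈ CP m n) (hF : F ∈ CP m n) : E + F ∈ CP m n :=
  fun k M hM => (hE k M hM).add (hF k M hM)

theorem posSemidef_of_mem_CP {E : Superop m n} (hE : E ∈ CP m n) {X : Matrix m m ℂ}
    (hX : X.PosSemidef) : (E X).PosSemidef :=
  (hE 1 (X.submatrix Prod.snd Prod.snd) (hX.submatrix _)).submatrix fun x => (0, x)

theorem CP_subset_HP : CP m n ⊆ HP m n := by
  classical
  intro E hE X hX
  open scoped MatrixOrder Matrix.Norms.L2Operator in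
  have hpos := Matrix.nonneg_iff_posSemidef.1 (CFC.posPart_nonneg X)
  have hneg := Matrix.nonneg_iff_posSemidef.1 (CFC.negPart_nonneg X)
  rw [← CFC.posPart_sub_negPart X hX, map_sub]
  exact (posSemidef_of_mem_CP hE hpos).1.sub (posSemidef_of_mem_CP hE hneg).1

end HermitianPreserving

/-! ### Measure-and-prepare maps -/

section MeasurePrepare

variable {m n : Type*} [Fintype m]

/-- The superoperator `X ↦ tr(M X) N`, bilinear in `M` and `N`: for an effect `M` and a density
matrix `N`, measure `M` and prepare `N` on success. -/
noncomputable def measurePrepare : Matrix m m ℂ →ₗ[ℂ] Matrix n n ℂ →ₗ[ℂ] Superop m n :=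
  LinearMap.smulRightₗ ∘ₗ (LinearMap.mul ℂ (Matrix m m ℂ)).compr₂ (Matrix.traceLinearMap m ℂ ℂ)

@[simp]
theorem measurePrepare_apply (M X : Matrix m m ℂ) (N : Matrix n n ℂ) :
    measurePrepare M N X = (M * X).trace • N := rfl

theorem map₂_measurePrepare_top :
    Submodule.map₂ (measurePrepare (m := m) (n := n)) ⊤ ⊤ = ⊤ := by
  classical
  refine eq_top_iff.2 fun E _ => ?_
  have hE : E = ∑ p, ∑ q, measurePrepare (Matrix.single q p 1) (E (Matrix.single p q 1)) := by
    ext1 X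
    have hsingle : ∀ p q, E (Matrix.single p q (X p q)) = X p q • E (Matrix.single p q 1) :=
      fun p q => by rw [← map_smul, Matrix.smul_single, smul_eq_mul, mul_one]
    conv_lhs => rw [Matrix.matrix_eq_sum_single X]
    simp [Matrix.trace_single_mul, hsingle]
  rw [hE]
  exact Submodule.sum_mem _ fun p _ => Submodule.sum_mem _ fun q _ =>
    Submodule.apply_mem_map₂ _ trivial trivial

theorem measurePrepare_mem_CP [Fintype n] {M : Matrix m m ℂ} {N : Matrix n n ℂ}
    (hM : M.PosSemidef) (hN : N.PosSemidef) : measurePrepare M N ∈ CP m n := by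
  classical
  intro k X hX
  obtain ⟨B, rfl⟩ : ∃ B : Matrix m m ℂ, M = B.conjTranspose * B := by
    open scoped MatrixOrder Matrix.Norms.L2Operator in
    exact CStarAlgebra.nonneg_iff_eq_star_mul_self.1 (Matrix.nonneg_iff_posSemidef.2 hM)
  have hampl : ampliation k (measurePrepare (B.conjTranspose * B) N) X =
      traceB (((1 : Matrix (Fin k) (Fin k) ℂ) ⊗ₖ B) * X *
        ((1 : Matrix (Fin k) (Fin k) ℂ) ⊗ₖ B).conjTranspose) ⊗ₖ N := by
    ext ⟨i, x⟩ ⟨j, y⟩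
    have hcycle : ∀ Y : Matrix m m ℂ,
        (B.conjTranspose * B * Y).trace = (B * Y * B.conjTranspose).trace := fun Y => by
      rw [Matrix.mul_assoc, Matrix.trace_mul_comm]
    simp only [ampliation, Matrix.of_apply, measurePrepare_apply, Matrix.smul_apply, smul_eq_mul,
      Matrix.kroneckerMap_apply, hcycle]
    congr 1
    simp [Matrix.trace, traceB, Matrix.mul_apply, Fintype.sum_prod_type, Matrix.one_apply,
      Finset.sum_mul, apply_ite]
  rw [hampl]
  exact (posSemidef_traceB (hX.mul_mul_conjTranspose_same _)).kronecker hN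

/-- The replacement map `X ↦ tr(X) ω`, which discards its input and prepares `ω`. -/
noncomputable def replacement (ω : Matrix n n ℂ) : Superop m n :=
  (Matrix.traceLinearMap m ℂ ℂ).smulRight ω

@[simp]
theorem replacement_apply (ω : Matrix n n ℂ) (X : Matrix m m ℂ) :
    replacement ω X = X.trace • ω := rfl

theorem replacement_mem_CPTP [Fintype n] {ω : Matrix n n ℂ} (hω : IsDensity ω) :
    replacement ω ∈ CPTP m n := by
  classical
  have hmp : (replacement ω : Superop m n) = measurePrepare 1 ω := by ext1 X; simp
  exact ⟨hmp ▸ measurePrepare_mem_CP .one hω.1, fun X => by simp [hω.2]⟩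

variable [DecidableEq m]

/-- The measure-and-prepare maps `X ↦ tr(M X) N` of an effect `M` and a density matrix `N`; they
are the generators used for spaces of superoperators. -/
def measurePrepareMaps (m n : Type*) [Fintype m] [Fintype n] [DecidableEq m] :
    Set (Superop m n) :=
  Set.image2 (fun M N => measurePrepare M N) {M | IsEffect M} {N | IsDensity N}

variable [Fintype n]

theorem measurePrepareMaps_subset_HP : measurePrepareMaps m n ⊆ HP m n := by
  rintro _ ⟨M, hM, N, hN, rfl⟩
  exact CP_subset_HP (measurePrepare_mem_CP hM.1 hN.1)

theorem span_measurePrepareMaps : Submodule.span ℂ (measurePrepareMaps m n) = ⊤ := by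
  rw [measurePrepareMaps, ← Submodule.map₂_span_span, span_isEffect, span_isDensity,
    map₂_measurePrepare_top]

theorem HP_subset_span_measurePrepareMaps :
    HP m n ⊆ Submodule.span ℝ (measurePrepareMaps m n) := fun _ hE =>
  mem_span_real_of_mem_HP measurePrepareMaps_subset_HP hE (span_measurePrepareMaps.ge trivial)

end MeasurePrepare

theorem span_HP {m n : Type*} [Finite m] [Finite n] : Submodule.span ℂ (HP m n) = ⊤ := by
  classical
  cases nonempty_fintype m
  cases nonempty_fintype n
  rw [eq_top_iff, ← span_measurePrepareMaps (m := m) (n := n)]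
  exact Submodule.span_mono measurePrepareMaps_subset_HP

/-! ### Tensor products of superoperators -/

section Tensor

variable {a b a' b' : Type*} [Fintype a] [Fintype b] [DecidableEq a] [DecidableEq b]

/-- The tensor product of superoperators as a bilinear map, to make the library's results on
bilinear maps and spans available. -/
noncomputable def tensorₗ : Superop a a' →ₗ[ℂ] Superop b b' →ₗ[ℂ] Superop (a × b) (a' × b') :=
  LinearMap.mk₂ ℂ tensor
    (fun _ _ _ => linearMap_ext_kronecker fun _ _ => by
      simp [tensor_kronecker, Matrix.add_kronecker])
    (fun _ _ _ => linearMap_ext_kronecker fun _ _ => by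
      simp [tensor_kronecker, Matrix.smul_kronecker])
    (fun _ _ _ => linearMap_ext_kronecker fun _ _ => by
      simp [tensor_kronecker, Matrix.kronecker_add])
    (fun _ _ _ => linearMap_ext_kronecker fun _ _ => by
      simp [tensor_kronecker, Matrix.kronecker_smul])

theorem tensorₗ_apply (E : Superop a a') (F : Superop b b') : tensorₗ E F = tensor E F := rfl

theorem smul_tensor_smul (s t : ℝ) (E : Superop a a') (F : Superop b b') :
    tensor (s • E) (t • F) = (s * t) • tensor E F :=
  linearMap_ext_kronecker fun X Y => by
    simp [tensor_kronecker, Matrix.smul_kronecker, Matrix.kronecker_smul, smul_smul, mul_comm]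

theorem tensor_comp {a'' b'' : Type*} [Fintype a'] [Fintype b'] [DecidableEq a'] [DecidableEq b']
    (E : Superop a a') (F : Superop b b') (E' : Superop a' a'') (F' : Superop b' b'') :
    tensor E' F' ∘ₗ tensor E F = tensor (E' ∘ₗ E) (F' ∘ₗ F) :=
  linearMap_ext_kronecker fun X Y => by simp [tensor_kronecker]

theorem tensor_mem_HP {E : Superop a a'} {F : Superop b b'} (hE : E ∈ HP a a')
    (hF : F ∈ HP b b') : tensor E F ∈ HP (a × b) (a' × b') := by
  have hconj : ∀ X, tensor E F X.conjTranspose = (tensor E F X).conjTranspose := fun X => by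
    induction X using kronecker_induction with
    | kronecker X Y =>
      simp only [Matrix.conjTranspose_kronecker, tensor_kronecker,
        map_conjTranspose_of_mem_HP hE, map_conjTranspose_of_mem_HP hF]
    | add X Y hX hY => simp only [Matrix.conjTranspose_add, map_add, hX, hY]
  exact fun X hX => (hconj X).symm.trans (congrArg _ hX)

theorem tensor_mem_span_image2 {S : Set (Superop a a')} {T : Set (Superop b b')}
    {E : Superop a a'} {F : Superop b b'} (hE : E ∈ Submodule.span ℝ S)
    (hF : F ∈ Submodule.span ℝ T) : tensor E F ∈ Submodule.span ℝ (Set.image2 tensor S T) := by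
  have hmem := Submodule.apply_mem_map₂ (LinearMap.restrictScalars₁₂ ℝ ℝ tensorₗ) hE hF
  rwa [Submodule.map₂_span_span] at hmem

theorem measurePrepare_kronecker (M : Matrix a a ℂ) (M' : Matrix b b ℂ)
    (N : Matrix a' a' ℂ) (N' : Matrix b' b' ℂ) :
    measurePrepare (M ⊗ₖ M') (N ⊗ₖ N') = tensor (measurePrepare M N) (measurePrepare M' N') :=
  linearMap_ext_kronecker fun X Y => by
    simp [tensor_kronecker, ← Matrix.mul_kronecker_mul, Matrix.trace_kronecker,
      Matrix.smul_kronecker, Matrix.kronecker_smul, smul_smul, mul_comm]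

theorem map₂_tensorₗ_top [Finite a'] [Finite b'] :
    Submodule.map₂ (tensorₗ (a := a) (b := b) (a' := a') (b' := b')) ⊤ ⊤ = ⊤ := by
  refine eq_top_iff.2 ?_
  rw [← map₂_measurePrepare_top (m := a × b) (n := a' × b')]
  refine Submodule.map₂_le.2 ?_
  rintro M - N -
  induction M using kronecker_induction with
  | add M M' hM hM' => rw [map_add]; exact Submodule.add_mem _ hM hM'
  | kronecker M M' =>
    induction N using kronecker_induction with
    | add N N' hN hN' => rw [map_add]; exact Submodule.add_mem _ hN hN'
    | kronecker N N' =>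
      rw [measurePrepare_kronecker]
      exact Submodule.apply_mem_map₂ tensorₗ trivial trivial

theorem HP_subset_span_image2_tensor [Finite a'] [Finite b'] : HP (a × b) (a' × b') ⊆
    Submodule.span ℝ (Set.image2 tensor (HP a a') (HP b b')) := by
  intro E hE
  have hsub : Set.image2 tensor (HP a a') (HP b b') ⊆ HP (a × b) (a' × b') :=
    Set.image2_subset_iff.2 fun _ hF _ hG => tensor_mem_HP hF hG
  refine mem_span_real_of_mem_HP hsub hE ?_
  have hspan := Submodule.map₂_span_span ℂ (tensorₗ (a' := a') (b' := b')) (HP a a') (HP b b')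
  rw [span_HP, span_HP, map₂_tensorₗ_top] at hspan
  exact hspan.le trivial

end Tensor

/-! ### Non-signalling maps -/

section NonSignalling

variable {a b a' b' : Type*} [Fintype a] [Fintype b]

/-- `NSIG a b a' b'` as a real vector space. -/
def nonSignalling (a b a' b' : Type*) [Fintype a] [Fintype b] [Fintype a'] [Fintype b'] :
    Submodule ℝ (Superop (a × b) (a' × b')) where
  carrier := NSIG a b a' b'
  zero_mem' := ⟨(hermitianPreserving _ _).zero_mem, fun _ _ _ _ _ => rfl, fun _ _ _ _ _ => rfl⟩
  add_mem' := fun hE hF => ⟨(hermitianPreserving _ _).add_mem hE.1 hF.1,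
    fun ρ σ hρ hσ h => by
      simp only [LinearMap.add_apply, traceB_add, hE.2.1 ρ σ hρ hσ h, hF.2.1 ρ σ hρ hσ h],
    fun ρ σ hρ hσ h => by
      simp only [LinearMap.add_apply, traceA_add, hE.2.2 ρ σ hρ hσ h, hF.2.2 ρ σ hρ hσ h]⟩
  smul_mem' := fun c _ hE => ⟨(hermitianPreserving _ _).smul_mem c hE.1,
    fun ρ σ hρ hσ h => by
      simp only [LinearMap.smul_apply, traceB_smul, hE.2.1 ρ σ hρ hσ h],
    fun ρ σ hρ hσ h => by
      simp only [LinearMap.smul_apply, traceA_smul, hE.2.2 ρ σ hρ hσ h]⟩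

variable [DecidableEq a] [DecidableEq b]

theorem traceA_tensor [Fintype a'] {E : Superop a a'} (hE : E ∈ TP a a') (F : Superop b b')
    (X : Matrix (a × b) (a × b) ℂ) : traceA (tensor E F X) = F (traceA X) := by
  induction X using kronecker_induction with
  | kronecker X Y => rw [tensor_kronecker, traceA_kronecker, traceA_kronecker, map_smul, hE X]
  | add X Y hX hY => simp only [map_add, traceA_add, hX, hY]

theorem traceB_tensor [Fintype b'] (E : Superop a a') {F : Superop b b'} (hF : F ∈ TP b b')
    (X : Matrix (a × b) (a × b) ℂ) : traceB (tensor E F X) = E (traceB X) := by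
  induction X using kronecker_induction with
  | kronecker X Y => rw [tensor_kronecker, traceB_kronecker, traceB_kronecker, map_smul, hF Y]
  | add X Y hX hY => simp only [map_add, traceB_add, hX, hY]

theorem tensor_mem_NSIG [Fintype a'] [Fintype b'] {E : Superop a a'} {F : Superop b b'}
    (hE : E ∈ CPTP a a') (hF : F ∈ CPTP b b') : tensor E F ∈ NSIG a b a' b' :=
  ⟨tensor_mem_HP (CP_subset_HP hE.1) (CP_subset_HP hF.1),
    fun ρ σ _ _ h => by rw [traceB_tensor E hF.2, traceB_tensor E hF.2, h],
    fun ρ σ _ _ h => by rw [traceA_tensor hE.2, traceA_tensor hE.2, h]⟩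

theorem tensor_replacement_id (ω : Matrix a' a' ℂ) (X : Matrix (a × b) (a × b) ℂ) :
    tensor (replacement ω) LinearMap.id X = ω ⊗ₖ traceA X := by
  induction X using kronecker_induction with
  | kronecker X Y =>
    simp [tensor_kronecker, traceA_kronecker, Matrix.smul_kronecker, Matrix.kronecker_smul]
  | add X Y hX hY => rw [map_add, traceA_add, Matrix.kronecker_add, hX, hY]

theorem tensor_id_replacement (ω : Matrix b' b' ℂ) (X : Matrix (a × b) (a × b) ℂ) :
    tensor LinearMap.id (replacement ω) X = traceB X ⊗ₖ ω := by
  induction X using kronecker_induction with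
  | kronecker X Y =>
    simp [tensor_kronecker, traceB_kronecker, Matrix.smul_kronecker, Matrix.kronecker_smul]
  | add X Y hX hY => rw [map_add, traceB_add, Matrix.add_kronecker, hX, hY]

end NonSignalling

/-! ### Corrections by replacement maps -/

section Correction

/-- `E ↦ E - D' ∘ E + D' ∘ E ∘ D`. When `D` and `D'` are replacement maps of density matrices, this
turns `E` into a map that scales the trace by a constant, and fixes `E` if it already does so. -/
noncomputable def correction {m n : Type*} (D : Superop m m) (D' : Superop n n) :
    Superop m n →ₗ[ℂ] Superop m n where
  toFun E := E - D' ∘ₗ E + D' ∘ₗ E ∘ₗ D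
  map_add' E F := by simp only [LinearMap.comp_add, LinearMap.add_comp]; abel
  map_smul' c E := by
    simp only [LinearMap.comp_smul, LinearMap.smul_comp, smul_add, smul_sub, RingHom.id_apply]

theorem correction_apply {m n : Type*} (D : Superop m m) (D' : Superop n n) (E : Superop m n) :
    correction D D' E = E - D' ∘ₗ E + D' ∘ₗ E ∘ₗ D := rfl

theorem correction_eq_self {m n : Type*} {D : Superop m m} {D' : Superop n n} {E : Superop m n}
    (h : D' ∘ₗ E ∘ₗ D = D' ∘ₗ E) : correction D D' E = E := by
  rw [correction_apply, h, sub_add_cancel]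

section SingleSystem

variable {m n : Type*} [Fintype m] [Fintype n]

theorem correction_measurePrepare_mem_span_CPTP [DecidableEq m] {ω M : Matrix m m ℂ}
    {τ N : Matrix n n ℂ} (hω : ω.IsHermitian) (hτ : IsDensity τ) (hM : IsEffect M)
    (hN : IsDensity N) : correction (replacement ω) (replacement τ) (measurePrepare M N) ∈
      Submodule.span ℝ (CPTP m n) := by
  have htrace : ((M * ω).trace.re : ℂ) = (M * ω).trace := by
    rw [← Complex.conj_eq_iff_re, starRingEnd_apply, ← Matrix.trace_conjTranspose,
      Matrix.conjTranspose_mul, hω.eq, hM.1.1.eq, Matrix.trace_mul_comm]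
  have hcompleted : measurePrepare M N + measurePrepare (1 - M) τ ∈ CPTP m n :=
    ⟨add_mem_CP (measurePrepare_mem_CP hM.1 hN.1) (measurePrepare_mem_CP hM.2 hτ.1),
      fun X => by simp [hN.2, hτ.2]⟩
  have hcorrection : correction (replacement ω) (replacement τ) (measurePrepare M N) =
      (measurePrepare M N + measurePrepare (1 - M) τ) +
        ((M * ω).trace.re - 1) • replacement τ := by
    ext1 X
    simp [correction_apply, hN.2, sub_smul, ← Complex.coe_smul, htrace, smul_smul,
      mul_comm]
    abel
  rw [hcorrection]
  exact Submodule.add_mem _ (Submodule.subset_span hcompleted)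
    (Submodule.smul_mem _ _ (Submodule.subset_span (replacement_mem_CPTP hτ)))

theorem correction_mem_span_CPTP {ω : Matrix m m ℂ} {τ : Matrix n n ℂ} (hω : ω.IsHermitian)
    (hτ : IsDensity τ) {E : Superop m n} (hE : E ∈ HP m n) :
    correction (replacement ω) (replacement τ) E ∈ Submodule.span ℝ (CPTP m n) := by
  classical
  suffices hle : Submodule.span ℝ (measurePrepareMaps m n) ≤ (Submodule.span ℝ (CPTP m n)).comap
      ((correction (replacement ω) (replacement τ)).restrictScalars ℝ) from
    hle (HP_subset_span_measurePrepareMaps hE)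
  refine Submodule.span_le.2 ?_
  rintro _ ⟨M, hM, N, hN, rfl⟩
  exact correction_measurePrepare_mem_span_CPTP hω hτ hM hN

end SingleSystem

variable {a b a' b' : Type*} [Fintype a] [Fintype b] [Fintype a'] [Fintype b']
  [DecidableEq a] [DecidableEq b]

section CorrectionOfTensor

variable [DecidableEq a'] [DecidableEq b']

theorem correction_tensor_left (D : Superop a a) (D' : Superop a' a') (E : Superop a a')
    (F : Superop b b') :
    correction (tensor D LinearMap.id) (tensor D' LinearMap.id) (tensor E F) =
      tensor (correction D D' E) F := by
  simp only [correction_apply, tensor_comp, LinearMap.id_comp, LinearMap.comp_id]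
  simp only [← tensorₗ_apply, map_add, map_sub, LinearMap.add_apply, LinearMap.sub_apply]

theorem correction_tensor_right (D : Superop b b) (D' : Superop b' b') (E : Superop a a')
    (F : Superop b b') :
    correction (tensor LinearMap.id D) (tensor LinearMap.id D') (tensor E F) =
      tensor E (correction D D' F) := by
  simp only [correction_apply, tensor_comp, LinearMap.id_comp, LinearMap.comp_id]
  simp only [← tensorₗ_apply, map_add, map_sub]

variable {E : Superop (a × b) (a' × b')}

theorem correction_eq_self_of_mem_NSIG_left (hE : E ∈ NSIG a b a' b') {ω : Matrix a a ℂ}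
    (hω : IsDensity ω) (τ : Matrix a' a' ℂ) :
    correction (tensor (replacement ω) LinearMap.id) (tensor (replacement τ) LinearMap.id) E =
      E := by
  refine correction_eq_self (linearMap_ext_isDensity fun ρ hρ => ?_)
  simp only [LinearMap.comp_apply, tensor_replacement_id]
  rw [hE.2.2 (ω ⊗ₖ traceA ρ) ρ (hω.kronecker hρ.traceA) hρ]
  rw [traceA_kronecker, hω.2, one_smul]

theorem correction_eq_self_of_mem_NSIG_right (hE : E ∈ NSIG a b a' b') {ω : Matrix b b ℂ}
    (hω : IsDensity ω) (τ : Matrix b' b' ℂ) :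
    correction (tensor LinearMap.id (replacement ω)) (tensor LinearMap.id (replacement τ)) E =
      E := by
  refine correction_eq_self (linearMap_ext_isDensity fun ρ hρ => ?_)
  simp only [LinearMap.comp_apply, tensor_id_replacement]
  rw [hE.2.1 (traceB ρ ⊗ₖ ω) ρ (hρ.traceB.kronecker hω) hρ]
  rw [traceB_kronecker, hω.2, one_smul]

end CorrectionOfTensor

theorem NSIG_subset_span_image2_tensor_CPTP [Nonempty a] [Nonempty b] [Nonempty a']
    [Nonempty b'] :
    NSIG a b a' b' ⊆ Submodule.span ℝ (Set.image2 tensor (CPTP a a') (CPTP b b')) := by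
  classical
  intro E hE
  obtain ⟨ω, hω⟩ := exists_isDensity (m := a)
  obtain ⟨ω', hω'⟩ := exists_isDensity (m := a')
  obtain ⟨τ, hτ⟩ := exists_isDensity (m := b)
  obtain ⟨τ', hτ'⟩ := exists_isDensity (m := b')
  let correctA : Superop (a × b) (a' × b') →ₗ[ℂ] Superop (a × b) (a' × b') :=
    correction (tensor (replacement ω) LinearMap.id) (tensor (replacement ω') LinearMap.id)
  let correctB : Superop (a × b) (a' × b') →ₗ[ℂ] Superop (a × b) (a' × b') :=
    correction (tensor LinearMap.id (replacement τ)) (tensor LinearMap.id (replacement τ'))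
  have hself : (correctB ∘ₗ correctA) E = E := by
    rw [LinearMap.comp_apply, correction_eq_self_of_mem_NSIG_left hE hω,
      correction_eq_self_of_mem_NSIG_right hE hτ]
  have hle : Submodule.span ℝ (Set.image2 tensor (HP a a') (HP b b')) ≤
      (Submodule.span ℝ (Set.image2 tensor (CPTP a a') (CPTP b b'))).comap
        ((correctB ∘ₗ correctA).restrictScalars ℝ) := by
    refine Submodule.span_le.2 (Set.image2_subset_iff.2 fun F hF G hG => ?_)
    have hFG : (correctB ∘ₗ correctA) (tensor F G) =
        tensor (correction (replacement ω) (replacement ω') F)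
          (correction (replacement τ) (replacement τ') G) := by
      rw [LinearMap.comp_apply, correction_tensor_left, correction_tensor_right]
    have hmem := tensor_mem_span_image2 (correction_mem_span_CPTP hω.1.1 hω' hF)
      (correction_mem_span_CPTP hτ.1.1 hτ' hG)
    rwa [← hFG] at hmem
  rw [← hself]
  exact hle (HP_subset_span_image2_tensor hE.1)

end Correction

/-! ### Instruments -/

section Instruments

variable {m n : Type*}

theorem Family.SumsTo.unique {G : Family m n} {E F : Superop m n} (hE : G.SumsTo E)
    (hF : G.SumsTo F) : E = F :=
  LinearMap.ext fun X => (hE X).unique (hF X)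

theorem Family.SumsTo.mem_HP {G : Family m n} {E : Superop m n} (hE : G.SumsTo E)
    (hG : ∀ i, G.map i ∈ HP m n) : E ∈ HP m n := by
  intro X hX
  have hsum := (hE X).matrix_conjTranspose
  simp only [fun i => (hG i X hX).eq] at hsum
  exact hsum.unique (hE X)

theorem Family.weight_one (G : Family m n) : G.weight (fun _ => 1) = G := by
  simp [Family.weight]

theorem inducedChannels_subset_sideInfo (Q : Set (Family m n)) :
    inducedChannels Q ⊆ sideInfo Q := by
  rintro E ⟨G, hG, hE⟩
  refine ⟨G, hG, fun _ => 1, fun _ => by simp, ?_⟩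
  rwa [G.weight_one]

/-- The subfamily of nonzero members: `QI` forbids zero maps, so a family of completely positive
maps that adds up to a channel is an instrument only after discarding them. -/
def Family.nonzeroPart (G : Family m n) : Family m n where
  ι := {i // G.map i ≠ 0}
  countable := by
    have := G.countable
    infer_instance
  map i := G.map i

theorem Family.SumsTo.nonzeroPart {G : Family m n} {w : G.ι → ℝ} {E : Superop m n}
    (h : (G.weight w).SumsTo E) : (G.nonzeroPart.weight fun i => w i.1).SumsTo E := fun X =>
  (hasSum_subtype_iff_of_support_subset (s := {i | G.map i ≠ 0}) fun i hi h0 => hi <| by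
    simp [Family.weight, h0]).2 (h X)

variable [Fintype m] [Fintype n]

theorem nonzeroPart_mem_QI {G : Family m n} (hG : ∀ i, G.map i ∈ CP m n) {E : Superop m n}
    (hE : E ∈ CPTP m n) (hGE : G.SumsTo E) : G.nonzeroPart ∈ QI m n := by
  refine ⟨fun i => ⟨hG i.1, i.2⟩, E, hE, ?_⟩
  rw [← G.weight_one] at hGE
  rw [← G.nonzeroPart.weight_one]
  exact hGE.nonzeroPart

theorem mem_sideInfo_QI_of_sumsTo {G : Family m n} (hG : ∀ i, G.map i ∈ CP m n)
    {E F : Superop m n} (hF : F ∈ CPTP m n) (hGF : G.SumsTo F) {w : G.ι → ℝ}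
    (hw : ∀ i, w i ∈ Set.Icc (-1 : ℝ) 1) (hE : (G.weight w).SumsTo E) : E ∈ sideInfo (QI m n) :=
  ⟨_, nonzeroPart_mem_QI hG hF hGF, _, fun i => hw i.1, hE.nonzeroPart⟩

theorem inducedChannels_QI : inducedChannels (QI m n) = CPTP m n := by
  refine Set.Subset.antisymm ?_ fun E hE => ?_
  · rintro E ⟨G, ⟨-, F, hF, hGF⟩, hGE⟩
    exact hGE.unique hGF ▸ hF
  · have hsum : Family.SumsTo ⟨Unit, inferInstance, fun _ => E⟩ E := fun X => by simp
    refine ⟨_, nonzeroPart_mem_QI (fun _ => hE.1) hE hsum, ?_⟩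
    rw [← Family.weight_one (Family.nonzeroPart _)]
    exact Family.SumsTo.nonzeroPart (w := fun _ => 1) (by rwa [Family.weight_one])

theorem mem_sideInfo_QI_of_add_mem_TP {E F : Superop m n} (hE : E ∈ CP m n) (hF : F ∈ CP m n)
    (hEF : E + F ∈ TP m n) : E ∈ sideInfo (QI m n) := by
  let G : Family m n := ⟨Bool, inferInstance, fun i => cond i E F⟩
  have hG : ∀ i, G.map i ∈ CP m n := by rintro (_ | _) <;> assumption
  have hGsum : G.SumsTo (E + F) := fun X => by
    simpa using hasSum_fintype fun i : Bool => (cond i E F) X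
  have hwsum : (G.weight fun i : Bool => cond i 1 0).SumsTo E := fun X => by
    simpa [G, Family.weight] using
      hasSum_fintype fun i : Bool => (cond i (1 : ℝ) 0 • cond i E F) X
  refine mem_sideInfo_QI_of_sumsTo hG ⟨add_mem_CP hE hF, hEF⟩ hGsum ?_ hwsum
  rintro (_ | _) <;> simp

theorem measurePrepareMaps_subset_sideInfo_QI [DecidableEq m] :
    measurePrepareMaps m n ⊆ sideInfo (QI m n) := by
  rintro _ ⟨M, hM, N, hN, rfl⟩
  exact mem_sideInfo_QI_of_add_mem_TP (measurePrepare_mem_CP hM.1 hN.1)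
    (measurePrepare_mem_CP hM.2 hN.1) fun X => by simp [hN.2]

theorem HP_subset_span_sideInfo_QI : HP m n ⊆ Submodule.span ℝ (sideInfo (QI m n)) := by
  classical
  exact HP_subset_span_measurePrepareMaps.trans
    (Submodule.span_mono measurePrepareMaps_subset_sideInfo_QI)

end Instruments

/-! ### Local operations -/

section Local

variable {a b a' b' : Type*} [Fintype a] [Fintype b] [DecidableEq a] [DecidableEq b]

theorem sumsTo_tensor {G : Family a a'} {H : Family b b'} {E : Superop a a'}
    {F : Superop b b'} (hG : G.SumsTo E) (hH : H.SumsTo F) :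
    (G.tensor H).SumsTo (tensor E F) := by
  intro X
  change HasSum (fun i : G.ι × H.ι => tensor (G.map i.1) (H.map i.2) X) _
  induction X using kronecker_induction with
  | kronecker X Y =>
    simp only [tensor_kronecker]
    have hXY := hasSum_kronecker (hG X) (hH Y)
    exact hXY
  | add X Y hX hY =>
    simp only [map_add]
    exact hX.add hY

theorem Family.weight_tensor_weight (G : Family a a') (H : Family b b') (w : G.ι → ℝ)
    (v : H.ι → ℝ) :
    (G.weight w).tensor (H.weight v) = (G.tensor H).weight fun i => w i.1 * v i.2 := by
  simp only [Family.tensor, Family.weight, smul_tensor_smul]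

variable [Fintype a'] [Fintype b']

theorem LO_eq_image2_tensor : LO a b a' b' = Set.image2 tensor (CPTP a a') (CPTP b b') := by
  simp only [← inducedChannels_QI]
  refine Set.Subset.antisymm ?_ (Set.image2_subset_iff.2 ?_)
  · rintro T ⟨_, ⟨G, hG, H, hH, rfl⟩, hT⟩
    obtain ⟨-, E, -, hGE⟩ := id hG
    obtain ⟨-, F, -, hHF⟩ := id hH
    exact ⟨E, ⟨G, hG, hGE⟩, F, ⟨H, hH, hHF⟩, (sumsTo_tensor hGE hHF).unique hT⟩
  · rintro E ⟨G, hG, hGE⟩ F ⟨H, hH, hHF⟩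
    exact ⟨_, ⟨G, hG, H, hH, rfl⟩, sumsTo_tensor hGE hHF⟩

theorem tensor_mem_LOStar {E : Superop a a'} {F : Superop b b'} (hE : E ∈ sideInfo (QI a a'))
    (hF : F ∈ sideInfo (QI b b')) : tensor E F ∈ LOStar a b a' b' := by
  obtain ⟨G, hG, w, hw, hGE⟩ := hE
  obtain ⟨H, hH, v, hv, hHF⟩ := hF
  refine ⟨_, ⟨G, hG, H, hH, rfl⟩, fun i => w i.1 * v i.2, fun i => ?_, ?_⟩
  · rw [Set.mem_Icc, ← abs_le, abs_mul]
    exact mul_le_one₀ (abs_le.2 (hw i.1)) (abs_nonneg _) (abs_le.2 (hv i.2))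
  · rw [← Family.weight_tensor_weight]
    exact sumsTo_tensor hGE hHF

theorem LOStar_subset_HP : LOStar a b a' b' ⊆ HP (a × b) (a' × b') := by
  rintro T ⟨_, ⟨G, ⟨hG, -⟩, H, ⟨hH, -⟩, rfl⟩, w, -, hT⟩
  exact hT.mem_HP fun i => (hermitianPreserving _ _).smul_mem (w i)
    (tensor_mem_HP (CP_subset_HP (hG i.1).1) (CP_subset_HP (hH i.2).1))

theorem span_LOStar :
    (Submodule.span ℝ (LOStar a b a' b') : Set (Superop (a × b) (a' × b'))) =
      HP (a × b) (a' × b') := by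
  refine Set.Subset.antisymm
    ((Submodule.span_le (p := hermitianPreserving (a × b) (a' × b'))).2 LOStar_subset_HP)
    (HP_subset_span_image2_tensor.trans (Submodule.span_le.2 (Set.image2_subset_iff.2 ?_)))
  intro E hE F hF
  exact Submodule.span_mono (Set.image2_subset_iff.2 fun _ hG _ hH => tensor_mem_LOStar hG hH)
    (tensor_mem_span_image2 (HP_subset_span_sideInfo_QI hE) (HP_subset_span_sideInfo_QI hF))

theorem LO_subset_NSIG : LO a b a' b' ⊆ NSIG a b a' b' := by
  rw [LO_eq_image2_tensor]
  exact Set.image2_subset_iff.2 fun _ hE _ hF => tensor_mem_NSIG hE hF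

variable [Nonempty a'] [Nonempty b']

theorem span_LO [Nonempty a] [Nonempty b] :
    (Submodule.span ℝ (LO a b a' b') : Set (Superop (a × b) (a' × b'))) = NSIG a b a' b' := by
  refine Set.Subset.antisymm
    ((Submodule.span_le (p := nonSignalling a b a' b')).2 LO_subset_NSIG) ?_
  rw [LO_eq_image2_tensor]
  exact NSIG_subset_span_image2_tensor_CPTP

theorem LO_nonempty : (LO a b a' b').Nonempty := by
  obtain ⟨ω, hω⟩ := exists_isDensity (m := a')
  obtain ⟨τ, hτ⟩ := exists_isDensity (m := b')
  rw [LO_eq_image2_tensor]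
  exact ⟨_, Set.mem_image2_of_mem (replacement_mem_CPTP hω) (replacement_mem_CPTP hτ)⟩

theorem LOStar_nonempty : (LOStar a b a' b').Nonempty :=
  LO_nonempty.mono (inducedChannels_subset_sideInfo _)

end Local

theorem extent_lt_top_iff {m n : Type*} {S : Set (Superop m n)} (hS : S.Nonempty)
    {E : Superop m n} : extent S E < ⊤ ↔ E ∈ Submodule.span ℝ S := by
  constructor
  · intro h
    obtain ⟨t, ⟨k, c, F, -, hF, rfl, -⟩, -⟩ := sInf_lt_iff.1 h
    exact Submodule.sum_mem _ fun i _ => Submodule.smul_mem _ _ (Submodule.subset_span (hF i))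
  · intro h
    obtain ⟨k, c, F, rfl⟩ := Submodule.mem_span_set'.1 h
    obtain ⟨F₀, hF₀⟩ := hS
    -- The term `0 • F₀` makes the number of summands positive.
    refine sInf_lt_iff.2 ⟨_, ⟨k + 1, Fin.cons 0 c, Fin.cons F₀ fun i => F i, by lia,
      fun i => ?_, ?_, rfl⟩, ENNReal.ofReal_lt_top⟩
    · exact Fin.cases hF₀ (fun i => by simp) i
    · simp [Fin.sum_univ_succ]

end CircuitCutting

theorem mainTheorem1 (a b a' b' : Type*)
    [Fintype a] [Fintype b] [Fintype a'] [Fintype b']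
    [DecidableEq a] [DecidableEq b]
    [Nonempty a] [Nonempty b] [Nonempty a'] [Nonempty b'] :
    (Submodule.span ℝ (LO a b a' b') : Set (Superop (a × b) (a' × b'))) = NSIG a b a' b' ∧
    (Submodule.span ℝ (LOStar a b a' b') : Set (Superop (a × b) (a' × b'))) =
      HP (a × b) (a' × b') ∧
    (∀ E : Superop (a × b) (a' × b'), extent (LO a b a' b') E < ⊤ ↔ E ∈ NSIG a b a' b') ∧
    (∀ E : Superop (a × b) (a' × b'),
      extent (LOStar a b a' b') E < ⊤ ↔ E ∈ HP (a × b) (a' × b')) ∧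
    (∀ E ∈ CPTP (a × b) (a' × b'), extent (LOStar a b a' b') E < ⊤) := by
  have hLO := span_LO (a := a) (b := b) (a' := a') (b' := b')
  have hLOStar := span_LOStar (a := a) (b := b) (a' := a') (b' := b')
  have hextent : ∀ E : Superop (a × b) (a' × b'),
      extent (LOStar a b a' b') E < ⊤ ↔ E ∈ HP (a × b) (a' × b') := fun E => by
    rw [extent_lt_top_iff LOStar_nonempty, ← hLOStar, SetLike.mem_coe]
  refine ⟨hLO, hLOStar, fun E => ?_, hextent, fun E hE => (hextent E).2 (CP_subset_HP hE.1)⟩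
  rw [extent_lt_top_iff LO_nonempty, ← hLO, SetLike.mem_coe]
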